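/- **Setting.** Let $f\colon\mathbb{R}^n\to\overline{\mathbb{R}}$ and $\bar x\in\mathbb{R}^n$. Let $\hat\partial f$ and $\partial f$ be the regular (Fréchet) and the limiting (Mordukhovich) subdifferential (both empty where $f$ is not finite). Put $$\mathcal V=\operatorname{span}(\partial f(\bar x)-\tilde g)\ \ (\tilde g\in\partial f(\bar x)\text{ arbitrary}),\qquad \mathcal U=\mathcal V^{\perp},$$ write $g_v=P_{\mathcal V}(g)$ for the orthogonal projection, and let $B_E(0,r)$ be the closed $r$-ball of a subspace $E$ about $0$ and $\operatorname{int}B_E(0,r)$ the open one. For $\epsilon>0$ let $$\epsilon\text{-}\mathrm{ri}\,\partial f(\bar x)=\{g:\ g+\operatorname{int}B_{\mathcal V}(0,\epsilon)\subset\partial f(\bar x)\},$$ and for $g\in\epsilon\text{-}\mathrm{ri}\,\partial f(\bar x)$ and $u\in\mathcal U$ let $$L_\epsilon(u;g_v)=\inf_{v\in B_{\mathcal V}(0,\epsilon)}\{f(\bar x+u+v)-\langle g_v,v\rangle\},\qquad W(u;g_v)=\operatorname*{argmin}_{v\in B_{\mathcal V}(0,\epsilon)}\{f(\bar x+u+v)-\langle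 g_v,v\rangle\}$$ (with $W(u;g_v)=\emptyset$ if the infimum is $+\infty$). *Prox-regularity.* $f$ is prox-regular at $\bar x$ for $g\in\partial f(\bar x)$ with respect to $\bar\epsilon>0$ and $\rho\ge0$ if $f$ is finite and locally l.s.c. at $\bar x$ and $f(x')\ge f(x)+\langle s,x'-x\rangle-\frac{\rho}{2}\|x'-x\|^2$ for all $x'$ with $\|x'-\bar x\|\le\bar\epsilon$, whenever $s\in\partial f(x)$, $\|s-g\|<\bar\epsilon$, $\|x-\bar x\|<\bar\epsilon$ and $f(x)<f(\bar x)+\bar\epsilon$. A set is prox-regular at a point for a normal vector if its indicator function is so for some constants. $f$ is properly prox-regular at $\bar x$ with respect to $\bar\epsilon$ and $\rho$ if it is prox-regular at $\bar x$ for every $g\in\partial f(\bar x)$ with respect to $\bar\epsilon$ and $\rho$, and $\operatorname{epi}f$ is prox-regular at $(\bar x,f(\bar x))$ for every vector $(g,-1)$ in the limiting normal cone $N_{\operatorname{epi}f}(\bar x,f(\bar x))$. *Fast track.* Let $\bar x$ be a local minimizer of $f$, $\delta>0$ and $v\colon\mathcal U\to\mathcal V$. The set $\mathcal M=\{\bar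 x+u+v(u):u\in B_{\mathcal U}(0,\delta)\}$ is a $\mathcal C^k$ fast track of $f$ leading to $\bar x$ if, on some neighbourhood of $0$ in $\mathcal U$, $v$ is $\mathcal C^k$ with $v(u)\in W(u;g_v)$ for all $g\in\epsilon\text{-}\mathrm{ri}\,\partial f(\bar x)$, and there is $\hat g\in\epsilon\text{-}\mathrm{ri}\,\partial f(\bar x)$ such that $L_\epsilon(\cdot;\hat g_v)$ is finite and $\mathcal C^k$ there. **Theorem.** Let $\bar x$ be a local minimizer of $f$ and let $\mathcal M=\{\bar x+u+v(u):u\in B_{\mathcal U}(0,\delta)\}$ be a $\mathcal C^1$ fast track of $f$ leading to $\bar x$, for some $\delta>0$. Assume: 1. $f$ is proper, l.s.c. on $\mathbb{R}^n$, and properly prox-regular at $\bar x$ with respect to $\bar\epsilon$ and $\rho$; 2. $0<\rho<2$ and $0<\epsilon<\bar\epsilon$; 3. there is $\hat\delta>0$ with $\hat\partial f(x)=\partial f(x)$ for all $x\in\mathcal M$ with $\|x-\bar x\|\le\hat\delta$; 4. there is $\tau\in(0,\delta]$ such that for all $u\in B_{\mathcal U}(0,\tau)$ one has $W(u;g_v)\cap\operatorname{int}B_{\mathcal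 V}(0,\epsilon)\ne\emptyset$ for every $g\in\epsilon\text{-}\mathrm{ri}\,\partial f(\bar x)$, and $v(u)\in\operatorname{int}B_{\mathcal V}(0,\epsilon)$; 5. $P_{\mathcal V}\big(\partial f(\bar x)\setminus\epsilon\text{-}\mathrm{ri}\,\partial f(\bar x)\big)\subset\liminf_{x\to\bar x,\;x\in\mathcal M}P_{\mathcal V}(\partial f(x))$, where $\liminf$ is the inner (Painlevé–Kuratowski) limit. Then $\partial f$ is inner-semicontinuous at $\bar x$ relative to $\mathcal M$, that is, $\bar x\in\mathcal M$ and $\partial f(\bar x)\subset\liminf_{x\to\bar x,\;x\in\mathcal M}\partial f(x)$. -/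

import Mathlib

open Filter Topology
open scoped RealInnerProductSpace

namespace UVDecomp

section

variable {E : Type*} [NormedAddCommGroup E] [InnerProductSpace ℝ E]

/-- `f` is finite at `x`. -/
def FiniteAt (f : E → EReal) (x : E) : Prop := f x ≠ ⊥ ∧ f x ≠ ⊤

/-- `f` is proper: it never takes the value `-∞` and is not identically `+∞`. -/
def IsProper (f : E → EReal) : Prop := (∀ x, f x ≠ ⊥) ∧ ∃ x, f x ≠ ⊤

/-- Regular (Fréchet) subdifferential: `f y ≥ f x + ⟪g, y - x⟫ + o(‖y - x‖)` as `y → x`;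
empty where `f` is not finite. -/
def regularSubdiff (f : E → EReal) (x : E) : Set E :=
  {g | FiniteAt f x ∧ ∀ c : ℝ, 0 < c → ∀ᶠ y in 𝓝 x,
    f x + ((⟪g, y - x⟫ - c * ‖y - x‖ : ℝ) : EReal) ≤ f y}

/-- Limiting (Mordukhovich) subdifferential: limits of regular subgradients along
`f`-attentive convergence `x k → x`, `f (x k) → f x`; empty where `f` is not finite. -/
def subdiff (f : E → EReal) (x : E) : Set E :=
  {g | FiniteAt f x ∧ ∃ (y : ℕ → E) (s : ℕ → E),
    Tendsto y atTop (𝓝 x) ∧ Tendsto (fun k => f (y k)) atTop (𝓝 (f x)) ∧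
    (∀ k, s k ∈ regularSubdiff f (y k)) ∧ Tendsto s atTop (𝓝 g)}

/-- Regular normals to `C` at `x`: `⟪w, y - x⟫ ≤ o(‖y - x‖)` as `y → x` in `C`;
empty if `x ∉ C`. -/
def regularNormalCone (C : Set E) (x : E) : Set E :=
  {w | x ∈ C ∧ ∀ c : ℝ, 0 < c → ∀ᶠ y in 𝓝[C] x, ⟪w, y - x⟫ ≤ c * ‖y - x‖}

/-- Limiting normal cone to `C` at `x`; empty if `x ∉ C`. -/
def normalCone (C : Set E) (x : E) : Set E :=
  {w | x ∈ C ∧ ∃ (y : ℕ → E) (s : ℕ → E), Tendsto y atTop (𝓝 x) ∧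
    (∀ k, y k ∈ C) ∧ (∀ k, s k ∈ regularNormalCone C (y k)) ∧ Tendsto s atTop (𝓝 w)}

/-- `f` is locally lower semicontinuous at `x` (a point where `f` is finite). -/
def LocallyLsc (f : E → EReal) (x : E) : Prop :=
  ∃ r : ℝ, 0 < r ∧ ∀ a : EReal, a ≤ f x + (r : EReal) →
    IsClosed {y | y ∈ Metric.closedBall x r ∧ f y ≤ a}

/-- `f` is prox-regular at `x₀` for the subgradient `w` with respect to `e` and `ρ`. -/
def ProxRegularAt (f : E → EReal) (x₀ w : E) (e ρ : ℝ) : Prop :=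
  FiniteAt f x₀ ∧ LocallyLsc f x₀ ∧ w ∈ subdiff f x₀ ∧ 0 < e ∧ 0 ≤ ρ ∧
    ∀ x s : E, s ∈ subdiff f x → ‖s - w‖ < e → ‖x - x₀‖ < e → f x < f x₀ + (e : EReal) →
      ∀ x' ∈ Metric.closedBall x₀ e,
        f x + ((⟪s, x' - x⟫ - ρ / 2 * ‖x' - x‖ ^ 2 : ℝ) : EReal) ≤ f x'

open Classical in
/-- The indicator function of `C`: `0` on `C`, `+∞` elsewhere. -/
noncomputable def indicatorFun (C : Set E) (x : E) : EReal := if x ∈ C then 0 else ⊤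

/-- The set `C` is prox-regular at `x₀` for the normal `w`. -/
def SetProxRegularAt (C : Set E) (x₀ w : E) : Prop :=
  ∃ e ρ : ℝ, ProxRegularAt (indicatorFun C) x₀ w e ρ

/-- The epigraph of `f`, in the Euclidean (`ℓ²`) product `E × ℝ`. -/
def epigraph (f : E → EReal) : Set (WithLp 2 (E × ℝ)) :=
  {p | f p.fst ≤ ((p.snd : ℝ) : EReal)}

/-- `f` is properly prox-regular at `x₀`, with the prox-regularity of `f` holding with respect
to `e` and `ρ` for every subgradient `g` at `x₀`; moreover the epigraph of `f` is
prox-regular at `(x₀, f x₀)` for every normal of the form `(g, -1)`. -/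
def ProperlyProxRegularAt (f : E → EReal) (x₀ : E) (e ρ : ℝ) : Prop :=
  (∀ g ∈ subdiff f x₀, ProxRegularAt f x₀ g e ρ) ∧
  (∀ g : E, WithLp.toLp 2 (g, (-1 : ℝ)) ∈
      normalCone (epigraph f) (WithLp.toLp 2 (x₀, (f x₀).toReal)) →
    SetProxRegularAt (epigraph f) (WithLp.toLp 2 (x₀, (f x₀).toReal))
      (WithLp.toLp 2 (g, (-1 : ℝ))))

/-- The inner limit (Painlevé–Kuratowski `liminf`) of the sets `S x` along a filter. -/
def innerLimit {X Y : Type*} [TopologicalSpace Y] (S : X → Set Y) (l : Filter X) : Set Y :=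
  {w | ∀ O ∈ 𝓝 w, ∀ᶠ x in l, (S x ∩ O).Nonempty}

/-- `S` is inner semicontinuous at `x₀ ∈ M` relative to `M`:
`S x₀ ⊆ liminf S x` as `x → x₀` in `M`. The inclusion is Mathlib's lower hemicontinuity
(see `innerSemicontinuousAtRel_iff`). -/
def InnerSemicontinuousAtRel {X Y : Type*} [TopologicalSpace X] [TopologicalSpace Y]
    (S : X → Set Y) (x₀ : X) (M : Set X) : Prop :=
  x₀ ∈ M ∧ LowerHemicontinuousWithinAt S M x₀

theorem innerSemicontinuousAtRel_iff {X Y : Type*} [TopologicalSpace X] [TopologicalSpace Y]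
    (S : X → Set Y) (x₀ : X) (M : Set X) :
    InnerSemicontinuousAtRel S x₀ M ↔ x₀ ∈ M ∧ S x₀ ⊆ innerLimit S (𝓝[M] x₀) := by
  refine and_congr_right fun _ => ?_
  rw [lowerHemicontinuousWithinAt_iff]
  constructor
  · intro h w hw O hO
    obtain ⟨O', hO', hopen, hmem⟩ := mem_nhds_iff.1 hO
    filter_upwards [h O' hopen ⟨w, hw, hmem⟩] with x hx
    exact hx.mono (Set.inter_subset_inter_right _ hO')
  · rintro h O hopen ⟨w, hw, hmem⟩
    exact h hw O (hopen.mem_nhds hmem)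

/-- `V = span (∂f(x₀) - g)` for an arbitrary `g ∈ ∂f(x₀)`: Mathlib's `vectorSpan` is the span of
all differences of elements, which is the same subspace for each choice of `g`. -/
noncomputable def vSpace (f : E → EReal) (x₀ : E) : Submodule ℝ E := vectorSpan ℝ (subdiff f x₀)

/-- `U = Vᗮ`. -/
noncomputable def uSpace (f : E → EReal) (x₀ : E) : Submodule ℝ E := (vSpace f x₀)ᗮ

/-- The `ε`-relative interior of `∂f(x₀)`: those `g` for which `g` plus the open `ε`-ball of
`V` is contained in `∂f(x₀)`. -/
def epsRi (f : E → EReal) (x₀ : E) (ε : ℝ) : Set E :=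
  {g | ∀ v ∈ vSpace f x₀, ‖v‖ < ε → g + v ∈ subdiff f x₀}

/-- The function `f (x₀ + u + v) - ⟪w, v⟫` that is minimized over `v`. -/
noncomputable def tilted (f : E → EReal) (x₀ : E) (w : vSpace f x₀) (u : uSpace f x₀)
    (v : vSpace f x₀) : EReal :=
  f (x₀ + (u : E) + (v : E)) - ((⟪(w : E), (v : E)⟫ : ℝ) : EReal)

/-- The (localized) `U`-Lagrangian `L_ε(u; w)`, the infimum of `f (x₀ + u + v) - ⟪w, v⟫`
over the closed `ε`-ball of `V`. -/
noncomputable def uLagrangian (f : E → EReal) (x₀ : E) (ε : ℝ) (w : vSpace f x₀)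
    (u : uSpace f x₀) : EReal :=
  ⨅ v ∈ Metric.closedBall (0 : vSpace f x₀) ε, tilted f x₀ w u v

/-- The set `W(u; w)` of minimizers over the closed `ε`-ball of `V`; by convention it is empty
if the infimum is `+∞`. -/
def vMinimizers (f : E → EReal) (x₀ : E) (ε : ℝ) (w : vSpace f x₀) (u : uSpace f x₀) :
    Set (vSpace f x₀) :=
  {v | v ∈ Metric.closedBall (0 : vSpace f x₀) ε ∧ uLagrangian f x₀ ε w u < ⊤ ∧
    tilted f x₀ w u v = uLagrangian f x₀ ε w u}

/-- The set `{x₀ + u + v u : u ∈ U, ‖u‖ ≤ δ}`. -/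
def trackSet (f : E → EReal) (x₀ : E) (δ : ℝ) (v : uSpace f x₀ → vSpace f x₀) : Set E :=
  (fun u : uSpace f x₀ => x₀ + (u : E) + (v u : E)) ''
    Metric.closedBall (0 : uSpace f x₀) δ

variable [FiniteDimensional ℝ E]

/-- The component `x_v`, the orthogonal projection of `x` onto `V`. -/
noncomputable def projV (f : E → EReal) (x₀ : E) (x : E) : vSpace f x₀ :=
  (vSpace f x₀).orthogonalProjectionOnto x

/-- `trackSet f x₀ δ v` is a `C^k` fast track leading to the local minimizer `x₀` of `f`: for all
small `u`, `v` is `C^k` with `v u` in `W(u; g_v)` for every `g` in the `ε`-relative interior, and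
for some `ghat` in the `ε`-relative interior `L_ε(·; ghat_v)` is (finite and) `C^k`. -/
def IsFastTrack (k : ℕ) (f : E → EReal) (x₀ : E) (ε δ : ℝ)
    (v : uSpace f x₀ → vSpace f x₀) : Prop :=
  IsLocalMin f x₀ ∧ 0 < δ ∧ ∃ η : ℝ, 0 < η ∧
    ContDiffOn ℝ k v (Metric.ball 0 η) ∧
    (∀ u ∈ Metric.ball (0 : uSpace f x₀) η, ∀ g ∈ epsRi f x₀ ε,
      v u ∈ vMinimizers f x₀ ε (projV f x₀ g) u) ∧
    ∃ ghat ∈ epsRi f x₀ ε, ∃ L : uSpace f x₀ → ℝ, ContDiffOn ℝ k L (Metric.ball 0 η) ∧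
      ∀ u ∈ Metric.ball (0 : uSpace f x₀) η,
        uLagrangian f x₀ ε (projV f x₀ ghat) u = ((L u : ℝ) : EReal)

end

end UVDecomp

namespace UVDecomp

section

/-! Along the track `f` equals `h u = L u + ⟪ghat_v, v u⟫`, which is `C¹` because `L` and `v` are.
Hence near `x₀` the subdifferentials on the track form a graph over their `V`-projections. By the
chain rule, the `U`-component of a regular subgradient with `V`-component `p` must be the gradient
of `h - ⟪p, v ·⟫` (`eq_trackSubgrad_of_mem_regularSubdiff`), and regular and limiting subgradients
agree there. This graph map is continuous in `(u, p)`, so only convergence of `V`-components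
remains.

Outside the `ε`-relative interior, that convergence is assumed. Inside it, the same `p` is attained
exactly at nearby track points, since an interior minimizer yields a regular subgradient
(`trackSubgrad_mem_regularSubdiff`). Prox-regularity with `ρ < 2` gives `v 0 = 0`
(`eq_zero_of_mem_vMinimizers_zero`), which puts `x₀` on the track and, by continuity, keeps `v u` in
the open ball. -/

theorem HasFDerivAt.eq_zero_of_forall_eventually_le {F : Type*} [NormedAddCommGroup F]
    [NormedSpace ℝ F] {φ : F → ℝ} {A : F →L[ℝ] ℝ} {u : F} (hA : HasFDerivAt φ A u)
    (h : ∀ c : ℝ, 0 < c → ∀ᶠ y in 𝓝 u, φ u - c * ‖y - u‖ ≤ φ y) : A = 0 := by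
  -- The lower bound along the ray in direction `d` makes the right slope at least `-c` for every `c
  -- > 0`; using both `d` and `-d` then forces `A = 0`.
  have key : ∀ d : F, 0 ≤ A d := by
    intro d
    have hline : HasDerivAt (fun t : ℝ => φ (u + t • d)) (A d) 0 := by
      have h1 : HasDerivAt (fun t : ℝ => u + t • d) d 0 := by
        simpa using ((hasDerivAt_id (0 : ℝ)).smul_const d).const_add u
      have h2 : HasFDerivAt φ A (u + (0 : ℝ) • d) := by simpa using hA
      exact h2.comp_hasDerivAt (0 : ℝ) h1
    refine le_of_forall_pos_le_add fun c hc => ?_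
    -- The `+ 1` covers `d = 0`; the error along the ray stays at most `c * t`.
    have hc' : 0 < c / (‖d‖ + 1) := by positivity
    have htend : Tendsto (fun t : ℝ => u + t • d) (𝓝[>] 0) (𝓝 u) := by
      have : Continuous fun t : ℝ => u + t • d := by fun_prop
      simpa using (this.tendsto 0).mono_left nhdsWithin_le_nhds
    have hslope := (hasDerivWithinAt_iff_tendsto_slope' (s := Set.Ioi (0 : ℝ)) (by simp)).1
      hline.hasDerivWithinAt
    have hle : -c ≤ A d := by
      refine ge_of_tendsto hslope ?_
      filter_upwards [htend.eventually (h _ hc'), self_mem_nhdsWithin] with t ht ht0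
      have ht0 : 0 < t := ht0
      rw [slope_def_field, le_div_iff₀ (by simpa using ht0)]
      simp only [add_sub_cancel_left, norm_smul, Real.norm_eq_abs, abs_of_pos ht0] at ht
      have h3 : c / (‖d‖ + 1) * (t * ‖d‖) ≤ c * t := by
        rw [div_mul_eq_mul_div, div_le_iff₀ (by positivity)]
        nlinarith [norm_nonneg d, mul_pos hc ht0]
      simp only [zero_smul, add_zero, sub_zero]
      linarith
    linarith
  ext d
  have h1 := key d
  have h2 := key (-d)
  rw [map_neg] at h2
  simp only [zero_apply]
  linarith

/-! ### Orthogonal splitting, and minimizers at the base point. -/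

variable {E : Type*} [NormedAddCommGroup E] [InnerProductSpace ℝ E]

theorem regularSubdiff_subset_subdiff (f : E → EReal) (x : E) :
    regularSubdiff f x ⊆ subdiff f x := fun g hg =>
  ⟨hg.1, fun _ => x, fun _ => g, tendsto_const_nhds, tendsto_const_nhds, fun _ => hg,
    tendsto_const_nhds⟩

theorem inner_vSpace_uSpace {f : E → EReal} {x₀ : E} (p : vSpace f x₀) (d : uSpace f x₀) :
    ⟪(p : E), (d : E)⟫ = 0 :=
  Submodule.inner_right_of_mem_orthogonal p.2 d.2

variable [FiniteDimensional ℝ E]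

theorem inner_projV_left {f : E → EReal} {x₀ : E} (s : E) (w : vSpace f x₀) :
    ⟪(projV f x₀ s : E), (w : E)⟫ = ⟪s, (w : E)⟫ := by
  rw [projV, ← Submodule.coe_inner]
  exact Submodule.inner_orthogonalProjectionOnto_eq_of_mem_right w s

/-- The minimizers at `u = 0` are trivial: prox-regularity gives `f (x₀ + v) - ⟪g, v⟫ ≥
f x₀ + ε ‖v‖ - ρ / 2 * ‖v‖ ^ 2`. -/
theorem eq_zero_of_mem_vMinimizers_zero {f : E → EReal} {x₀ g : E} {e ρ ε : ℝ}
    (hprox : ∀ g ∈ subdiff f x₀, ProxRegularAt f x₀ g e ρ) (hρ : ρ < 2) (hε : 0 < ε)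
    (hεe : ε < e) (hg : g ∈ epsRi f x₀ ε) {v : vSpace f x₀}
    (hv : v ∈ vMinimizers f x₀ ε (projV f x₀ g) 0) : v = 0 := by
  by_contra hne
  have hpos : 0 < ‖v‖ := norm_pos_iff.2 hne
  obtain ⟨hball, -, heq⟩ := hv
  have hnorm : ‖v‖ ≤ ε := by simpa using hball
  have hle : tilted f x₀ (projV f x₀ g) 0 v ≤ tilted f x₀ (projV f x₀ g) 0 0 := by
    rw [heq]
    exact iInf₂_le _ (by simpa using hε.le)
  -- The midpoint of `ρ / 2 * ε` and `ε`: below `ε`, so that `g + t v / ‖v‖` is still a subgradient,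
  -- and large enough to beat the quadratic term on the `ε`-ball. The gap exists because `ρ < 2`.
  set t : ℝ := (1 + ρ / 2) / 2 * ε with ht
  have hρ0 : 0 ≤ ρ := by
    have h0 : g ∈ subdiff f x₀ := by simpa using hg 0 (Submodule.zero_mem _) (by simpa using hε)
    exact (hprox g h0).2.2.2.2.1
  have ht0 : 0 ≤ t := by positivity
  have htε : t < ε := by nlinarith
  have htρ : ρ / 2 * ε < t := by nlinarith
  have hs : g + ((t / ‖v‖) • v : vSpace f x₀) ∈ subdiff f x₀ := by
    refine hg _ (Subtype.property _) ?_
    rw [Submodule.norm_coe, norm_smul, Real.norm_eq_abs, abs_of_nonneg (by positivity),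
      div_mul_cancel₀ _ hpos.ne']
    exact htε
  -- The shifted subgradient serves as its own reference vector, so the closeness condition is
  -- trivial.
  obtain ⟨⟨hbot, htop⟩, -, -, he, -, hineq⟩ := hprox _ hs
  lift f x₀ to ℝ using ⟨htop, hbot⟩ with F hF
  have h1 := hineq x₀ _ hs (by simpa using he) (by simpa using he)
    (by rw [← hF, ← EReal.coe_add]; exact EReal.coe_lt_coe_iff.2 (by linarith))
    (x₀ + v) (by simpa using hnorm.trans hεe.le)
  simp only [tilted, Submodule.coe_zero, add_zero, inner_zero_right, EReal.coe_zero,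
    sub_zero, inner_projV_left, ← hF] at hle
  rw [← hF] at h1
  have h2 := (EReal.sub_le_sub h1 (le_refl ((⟪g, (v : E)⟫ : ℝ) : EReal))).trans hle
  rw [← EReal.coe_add, ← EReal.coe_sub, EReal.coe_le_coe_iff] at h2
  simp only [add_sub_cancel_left, inner_add_left, Submodule.coe_smul, real_inner_smul_left,
    real_inner_self_eq_norm_sq, Submodule.norm_coe] at h2
  have h3 : t / ‖v‖ * ‖v‖ ^ 2 = t * ‖v‖ := by field_simp
  rw [h3] at h2
  have h4 : t * ‖v‖ ≤ ρ / 2 * ε * ‖v‖ := by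
    have : ρ / 2 * ‖v‖ * ‖v‖ ≤ ρ / 2 * ε * ‖v‖ := by gcongr
    linarith
  exact absurd (mul_lt_mul_of_pos_right htρ hpos) h4.not_gt

/-! ### Subgradients along the track as a graph over `V`. -/

/-- The subgradient with `V`-component `p` whose `U`-component is the gradient of
`u ↦ h u - ⟪p, v u⟫`, where `A` and `B` are the derivatives of `h` and `v`. -/
noncomputable def trackSubgrad {f : E → EReal} {x₀ : E} (A : uSpace f x₀ →L[ℝ] ℝ)
    (B : uSpace f x₀ →L[ℝ] vSpace f x₀) (p : vSpace f x₀) : E :=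
  p + ((InnerProductSpace.toDual ℝ (uSpace f x₀)).symm (A - (innerSL ℝ p).comp B) : uSpace f x₀)

theorem projV_trackSubgrad {f : E → EReal} {x₀ : E} (A : uSpace f x₀ →L[ℝ] ℝ)
    (B : uSpace f x₀ →L[ℝ] vSpace f x₀) (p : vSpace f x₀) :
    projV f x₀ (trackSubgrad A B p) = p := by
  refine ext_inner_right ℝ fun w => ?_
  rw [Submodule.coe_inner, Submodule.coe_inner, inner_projV_left, trackSubgrad, inner_add_left,
    add_eq_left, real_inner_comm]
  exact inner_vSpace_uSpace w _

theorem inner_trackSubgrad_add {f : E → EReal} {x₀ : E} (A : uSpace f x₀ →L[ℝ] ℝ)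
    (B : uSpace f x₀ →L[ℝ] vSpace f x₀) (p w : vSpace f x₀) (d : uSpace f x₀) :
    ⟪trackSubgrad A B p, (d : E) + (w : E)⟫ = ⟪p, w⟫ + (A d - ⟪p, B d⟫) := by
  have h : ∀ r : uSpace f x₀, ⟪(p : E) + r, (d : E) + (w : E)⟫ = ⟪p, w⟫ + ⟪r, d⟫ := fun r => by
    rw [inner_add_left, inner_add_right, inner_add_right, inner_vSpace_uSpace,
      real_inner_comm (w : E) (r : E), inner_vSpace_uSpace, Submodule.coe_inner,
      Submodule.coe_inner]
    ring
  rw [trackSubgrad, h, InnerProductSpace.toDual_symm_apply]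
  rfl

theorem continuous_trackSubgrad {f : E → EReal} {x₀ : E} :
    Continuous fun q : ((uSpace f x₀ →L[ℝ] ℝ) × (uSpace f x₀ →L[ℝ] vSpace f x₀)) × vSpace f x₀ =>
      trackSubgrad q.1.1 q.1.2 q.2 := by
  unfold trackSubgrad
  have h : Continuous fun q : ((uSpace f x₀ →L[ℝ] ℝ) × (uSpace f x₀ →L[ℝ] vSpace f x₀)) ×
      vSpace f x₀ => q.1.1 - (innerSL ℝ q.2).comp q.1.2 := by
    refine (continuous_fst.comp continuous_fst).sub (Continuous.clm_comp ?_ (by fun_prop))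
    exact (innerSL ℝ).continuous.comp continuous_snd
  exact (continuous_subtype_val.comp continuous_snd).add (continuous_subtype_val.comp
    ((InnerProductSpace.toDual ℝ (uSpace f x₀)).symm.continuous.comp h))

/-- A regular subgradient at a point of the track is determined by its `V`-component. -/
theorem eq_trackSubgrad_of_mem_regularSubdiff {f : E → EReal} {x₀ s : E}
    {v : uSpace f x₀ → vSpace f x₀} {h : uSpace f x₀ → ℝ} {A : uSpace f x₀ →L[ℝ] ℝ}
    {B : uSpace f x₀ →L[ℝ] vSpace f x₀} {u : uSpace f x₀}
    (hf : ∀ᶠ y : uSpace f x₀ in 𝓝 u, f (x₀ + (y : E) + (v y : E)) = (h y : EReal))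
    (hA : HasFDerivAt h A u) (hB : HasFDerivAt v B u)
    (hs : s ∈ regularSubdiff f (x₀ + (u : E) + (v u : E))) :
    s = trackSubgrad A B (projV f x₀ s) := by
  set Φ : uSpace f x₀ → E := fun y => x₀ + (y : E) + (v y : E) with hΦ
  have hD : HasFDerivAt Φ ((uSpace f x₀).subtypeL + (vSpace f x₀).subtypeL.comp B) u :=
    ((uSpace f x₀).subtypeL.hasFDerivAt.const_add x₀).add
      ((vSpace f x₀).subtypeL.hasFDerivAt.comp u hB)
  have hψ : HasFDerivAt (fun y => h y - ⟪s, Φ y⟫) (A - (innerSL ℝ s).comp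
      ((uSpace f x₀).subtypeL + (vSpace f x₀).subtypeL.comp B)) u :=
    hA.sub ((innerSL ℝ s).hasFDerivAt.comp u hD)
  -- The subgradient inequality pulls back along `Φ`; testing it with `c / K`, where `K` bounds `‖Φ
  -- y - Φ u‖ / ‖y - u‖` near `u`, absorbs the change of norm.
  have hzero := HasFDerivAt.eq_zero_of_forall_eventually_le hψ fun c hc => by
    obtain ⟨K, hK, hKb⟩ := hD.isBigO_sub.exists_pos
    filter_upwards [hf, hKb.bound, hD.continuousAt.eventually (hs.2 (c / K) (by positivity))]
      with y hy hyK hys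
    rw [show x₀ + (u : E) + (v u : E) = Φ u from rfl, show f (Φ u) = (h u : EReal) from
      hf.self_of_nhds, show f (Φ y) = (h y : EReal) from hy, ← EReal.coe_add,
      EReal.coe_le_coe_iff, inner_sub_right] at hys
    have : c / K * ‖Φ y - Φ u‖ ≤ c * ‖y - u‖ := by
      calc c / K * ‖Φ y - Φ u‖ ≤ c / K * (K * ‖y - u‖) := by gcongr
        _ = c * ‖y - u‖ := by field_simp
    linarith
  have hperp : s - projV f x₀ s ∈ uSpace f x₀ := by
    refine (Submodule.mem_orthogonal' _ _).2 fun w hw => ?_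
    rw [inner_sub_left, inner_projV_left s ⟨w, hw⟩, sub_self]
  have hr : (⟨s - projV f x₀ s, hperp⟩ : uSpace f x₀) = (InnerProductSpace.toDual ℝ
      (uSpace f x₀)).symm (A - (innerSL ℝ (projV f x₀ s)).comp B) := by
    refine ext_inner_right ℝ fun d => ?_
    have hd := DFunLike.congr_fun hzero d
    simp only [sub_apply, ContinuousLinearMap.comp_apply,
      add_apply, innerSL_apply_apply, Submodule.subtypeL_apply,
      zero_apply, inner_add_right] at hd
    rw [InnerProductSpace.toDual_symm_apply, Submodule.coe_inner]
    simp only [sub_apply, ContinuousLinearMap.comp_apply,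
      innerSL_apply_apply, inner_sub_left, inner_vSpace_uSpace, Submodule.coe_inner,
      inner_projV_left]
    linarith
  rw [trackSubgrad, ← hr]
  simp

/-- An interior minimizer over `V` along the track yields a regular subgradient with the
prescribed `V`-component. -/
theorem trackSubgrad_mem_regularSubdiff {f : E → EReal} {x₀ : E} {ε : ℝ}
    {v : uSpace f x₀ → vSpace f x₀} {h : uSpace f x₀ → ℝ} {A : uSpace f x₀ →L[ℝ] ℝ}
    {B : uSpace f x₀ →L[ℝ] vSpace f x₀} {u : uSpace f x₀} {p : vSpace f x₀}
    (hf : ∀ᶠ y : uSpace f x₀ in 𝓝 u, f (x₀ + (y : E) + (v y : E)) = (h y : EReal))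
    (hA : HasFDerivAt h A u) (hB : HasFDerivAt v B u)
    (hmin : ∀ᶠ y in 𝓝 u, v y ∈ vMinimizers f x₀ ε p y) (hvu : ‖v u‖ < ε) :
    trackSubgrad A B p ∈ regularSubdiff f (x₀ + (u : E) + (v u : E)) := by
  have hfu := hf.self_of_nhds
  refine ⟨⟨by rw [hfu]; simp, by rw [hfu]; simp⟩, fun c hc => ?_⟩
  -- Near `u` this function is `L_ε(·; p)`, so differentiability passes from `h` and `v` to the
  -- Lagrangian for this `p`.
  have hL : HasFDerivAt (fun y => h y - ⟪p, v y⟫) (A - (innerSL ℝ p).comp B) u :=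
    hA.sub ((innerSL ℝ p).hasFDerivAt.comp u hB)
  set x : E := x₀ + (u : E) + (v u : E) with hx
  set a : E → uSpace f x₀ := fun y => (uSpace f x₀).orthogonalProjectionOnto (y - x) with ha
  set b : E → vSpace f x₀ := fun y => (vSpace f x₀).orthogonalProjectionOnto (y - x) with hb
  have hsplit : ∀ y, y - x = (a y : E) + (b y : E) := fun y => by
    have := Submodule.starProjection_add_starProjection_orthogonal (K := vSpace f x₀) (y - x)
    rw [add_comm]
    exact this.symm
  have ha0 : Tendsto (fun y => u + a y) (𝓝 x) (𝓝 u) := by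
    have : Continuous fun y => u + a y := by fun_prop
    simpa [ha] using this.tendsto x
  have hb0 : Tendsto (fun y => v u + b y) (𝓝 x) (𝓝 (v u)) := by
    have : Continuous fun y => v u + b y := by fun_prop
    simpa [hb] using this.tendsto x
  filter_upwards [ha0.eventually hf, ha0.eventually hmin,
    ha0.eventually (hL.isLittleO.def hc), hb0.norm.eventually (gt_mem_nhds hvu)]
    with y hfy hminy hLy hby
  have hxy : x₀ + ((u + a y : uSpace f x₀) : E) + ((v u + b y : vSpace f x₀) : E) = y := by
    have := eq_add_of_sub_eq' (hsplit y)
    refine Eq.trans ?_ this.symm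
    rw [hx]
    push_cast
    abel
  -- The point `y` has `V`-coordinate `v u + b y`, an admissible competitor because `v u` is
  -- interior. Thus `f y - ⟪p, v u + b y⟫` dominates the Lagrangian at `u + a y`, whose first-order
  -- expansion finishes the proof.
  have hle : tilted f x₀ p (u + a y) (v (u + a y)) ≤ tilted f x₀ p (u + a y) (v u + b y) := by
    rw [hminy.2.2]
    exact iInf₂_le _ (by simpa using hby.le)
  rw [tilted, tilted, hfy, hxy, ← EReal.coe_sub,
    EReal.le_sub_iff_add_le (by simp) (by simp), ← EReal.coe_add] at hle
  rw [hfu, ← EReal.coe_add]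
  refine le_trans (EReal.coe_le_coe_iff.2 ?_) hle
  rw [hsplit y, inner_trackSubgrad_add, ← hsplit y]
  have hay : ‖a y‖ ≤ ‖y - x‖ := Submodule.norm_orthogonalProjectionOnto_apply_le _ _
  simp only [add_sub_cancel_left, sub_apply, ContinuousLinearMap.comp_apply,
    innerSL_apply_apply, Real.norm_eq_abs] at hLy
  have h1 := (abs_le.1 hLy).1
  have h2 : c * ‖a y‖ ≤ c * ‖y - x‖ := by gcongr
  rw [← Submodule.coe_inner, ← Submodule.coe_inner, inner_add_right]
  linarith

/-! ### Inner semicontinuity along the track. -/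

theorem IsFastTrack.innerSemicontinuousAtRel {f : E → EReal} {x₀ : E} {e ρ ε δ : ℝ}
    {v : uSpace f x₀ → vSpace f x₀}
    (hprox : ∀ g ∈ subdiff f x₀, ProxRegularAt f x₀ g e ρ) (hρ : ρ < 2) (hε : 0 < ε)
    (hεe : ε < e) (hfast : IsFastTrack 1 f x₀ ε δ v)
    (hreg : ∃ r : ℝ, 0 < r ∧ ∀ x ∈ Metric.closedBall x₀ r ∩ trackSet f x₀ δ v,
      regularSubdiff f x = subdiff f x)
    (hliminf : projV f x₀ '' (subdiff f x₀ \ epsRi f x₀ ε) ⊆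
      innerLimit (fun x => projV f x₀ '' subdiff f x) (𝓝[trackSet f x₀ δ v] x₀)) :
    InnerSemicontinuousAtRel (subdiff f) x₀ (trackSet f x₀ δ v) := by
  obtain ⟨-, hδ, η, hη, hv, hW, ghat, hghat, L, hL, hLeq⟩ := hfast
  have h0η : (0 : uSpace f x₀) ∈ Metric.ball 0 η := Metric.mem_ball_self hη
  have hv0 : v 0 = 0 :=
    eq_zero_of_mem_vMinimizers_zero hprox hρ hε hεe hghat (hW 0 h0η ghat hghat)
  have hx₀ : x₀ ∈ trackSet f x₀ δ v := ⟨0, by simpa using hδ.le, by simp [hv0]⟩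
  refine (innerSemicontinuousAtRel_iff _ _ _).2 ⟨hx₀, fun w hw O hO => ?_⟩
  set h : uSpace f x₀ → ℝ := fun u => L u + ⟪projV f x₀ ghat, v u⟫ with hh
  have hf : ∀ u ∈ Metric.ball (0 : uSpace f x₀) η,
      f (x₀ + (u : E) + (v u : E)) = (h u : EReal) := fun u hu => by
    have h1 := (hW u hu ghat hghat).2.2
    rw [hLeq u hu, tilted] at h1
    rw [hh, EReal.coe_add, ← h1, Submodule.coe_inner, EReal.sub_add_cancel]
  have hhC : ContDiffOn ℝ 1 h (Metric.ball 0 η) := hL.add (contDiffOn_const.inner ℝ hv)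
  have hnhds : ∀ u ∈ Metric.ball (0 : uSpace f x₀) η, Metric.ball 0 η ∈ 𝓝 u := fun u hu =>
    Metric.isOpen_ball.mem_nhds hu
  have hA : ∀ u ∈ Metric.ball (0 : uSpace f x₀) η, HasFDerivAt h (fderiv ℝ h u) u :=
    fun u hu => ((hhC.contDiffAt (hnhds u hu)).differentiableAt one_ne_zero).hasFDerivAt
  have hB : ∀ u ∈ Metric.ball (0 : uSpace f x₀) η, HasFDerivAt v (fderiv ℝ v u) u :=
    fun u hu => ((hv.contDiffAt (hnhds u hu)).differentiableAt one_ne_zero).hasFDerivAt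
  have hfev : ∀ u ∈ Metric.ball (0 : uSpace f x₀) η,
      ∀ᶠ y : uSpace f x₀ in 𝓝 u, f (x₀ + (y : E) + (v y : E)) = (h y : EReal) := fun u hu =>
    Filter.mem_of_superset (hnhds u hu) hf
  obtain ⟨r, hr, hreg⟩ := hreg
  have hrep : ∀ u ∈ Metric.ball (0 : uSpace f x₀) η, x₀ + (u : E) + (v u : E) ∈
      Metric.closedBall x₀ r ∩ trackSet f x₀ δ v → ∀ s ∈ subdiff f (x₀ + (u : E) + (v u : E)),
      s = trackSubgrad (fderiv ℝ h u) (fderiv ℝ v u) (projV f x₀ s) := fun u hu hx s hs =>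
    eq_trackSubgrad_of_mem_regularSubdiff (hfev u hu) (hA u hu) (hB u hu) (by rwa [hreg _ hx])
  have hw0 : w = trackSubgrad (fderiv ℝ h 0) (fderiv ℝ v 0) (projV f x₀ w) := by
    have hx0 : x₀ + ((0 : uSpace f x₀) : E) + (v 0 : E) = x₀ := by simp [hv0]
    exact hrep 0 h0η (by rw [hx0]; exact ⟨Metric.mem_closedBall_self hr.le, hx₀⟩) w
      (by rwa [hx0])
  have hprojU : Tendsto (fun x => (uSpace f x₀).orthogonalProjectionOnto (x - x₀)) (𝓝 x₀)
      (𝓝 0) := by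
    have : Continuous fun x => (uSpace f x₀).orthogonalProjectionOnto (x - x₀) := by fun_prop
    simpa using this.tendsto x₀
  -- The parameter `u` is a continuous function of the track point, so `x → x₀` on the track forces
  -- `u → 0`.
  have hcoord : ∀ u : uSpace f x₀, (uSpace f x₀).orthogonalProjectionOnto
      (x₀ + (u : E) + (v u : E) - x₀) = u := fun u => by
    have h1 : (uSpace f x₀).orthogonalProjectionOnto (v u : E) = 0 :=
      Submodule.orthogonalProjectionOnto_orthogonal_apply_eq_zero (v u).2
    rw [show x₀ + (u : E) + (v u : E) - x₀ = (u : E) + (v u : E) by abel, map_add, h1,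
      Submodule.orthogonalProjectionOnto_mem_subspace_eq_self, add_zero]
  have hproj : projV f x₀ w ∈
      innerLimit (fun x => projV f x₀ '' subdiff f x) (𝓝[trackSet f x₀ δ v] x₀) := by
    by_cases hwε : w ∈ epsRi f x₀ ε
    · intro P hP
      have hvε : ∀ᶠ u in 𝓝 (0 : uSpace f x₀), ‖v u‖ < ε := by
        have := (hB 0 h0η).continuousAt.norm
        exact this.eventually (gt_mem_nhds (by simpa [hv0] using hε))
      filter_upwards [self_mem_nhdsWithin, nhdsWithin_le_nhds (hprojU.eventually hvε),
        nhdsWithin_le_nhds (hprojU.eventually (Metric.ball_mem_nhds _ hη))] with x hx hxε hxη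
      obtain ⟨u, -, rfl⟩ := hx
      simp only [hcoord] at hxε hxη
      refine ⟨projV f x₀ w, ⟨trackSubgrad (fderiv ℝ h u) (fderiv ℝ v u) (projV f x₀ w), ?_,
        projV_trackSubgrad _ _ _⟩, mem_of_mem_nhds hP⟩
      exact regularSubdiff_subset_subdiff _ _ (trackSubgrad_mem_regularSubdiff (hfev u hxη)
        (hA u hxη) (hB u hxη) (Filter.mem_of_superset (hnhds u hxη) fun y hy => hW y hy w hwε)
        hxε)
    · exact hliminf ⟨w, ⟨hw, hwε⟩, rfl⟩
  -- The `C¹` hypothesis makes both derivatives continuous at `0`; the limit is `w` because `w`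
  -- itself lies on the graph over `u = 0`.
  have hcont : Tendsto (fun q : uSpace f x₀ × vSpace f x₀ =>
      trackSubgrad (fderiv ℝ h q.1) (fderiv ℝ v q.1) q.2) (𝓝 0 ×ˢ 𝓝 (projV f x₀ w)) (𝓝 w) := by
    have h1 : ContinuousAt (fderiv ℝ h) 0 :=
      (hhC.continuousOn_fderiv_of_isOpen Metric.isOpen_ball le_rfl).continuousAt (hnhds 0 h0η)
    have h2 : ContinuousAt (fderiv ℝ v) 0 :=
      (hv.continuousOn_fderiv_of_isOpen Metric.isOpen_ball le_rfl).continuousAt (hnhds 0 h0η)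
    have h3 := (continuous_trackSubgrad (f := f) (x₀ := x₀)).tendsto
      ((fderiv ℝ h 0, fderiv ℝ v 0), projV f x₀ w)
    rw [← hw0, nhds_prod_eq, nhds_prod_eq] at h3
    exact h3.comp ((h1.prodMk h2 |>.tendsto.mono_right nhds_prod_eq.le).prodMap tendsto_id)
  obtain ⟨Q, hQ, P, hP, hQP⟩ := Filter.mem_prod_iff.1 (hcont hO)
  filter_upwards [self_mem_nhdsWithin, hproj P hP,
    nhdsWithin_le_nhds (hprojU.eventually hQ),
    nhdsWithin_le_nhds (hprojU.eventually (Metric.ball_mem_nhds _ hη)),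
    nhdsWithin_le_nhds (Metric.closedBall_mem_nhds x₀ hr)] with x hx hxP hxQ hxη hxr
  obtain ⟨_, ⟨s, hs, rfl⟩, hsP⟩ := hxP
  have hxM := hx
  obtain ⟨u, -, rfl⟩ := hx
  simp only [hcoord] at hxQ hxη
  refine ⟨s, hs, ?_⟩
  rw [hrep u hxη ⟨hxr, hxM⟩ s hs]
  exact hQP (Set.mk_mem_prod hxQ hsP)

end

end UVDecomp

theorem mainTheorem5 {n : ℕ} (f : EuclideanSpace ℝ (Fin n) → EReal)
    (xbar : EuclideanSpace ℝ (Fin n)) (epsbar ρ ε δ : ℝ)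
    (v : UVDecomp.uSpace f xbar → UVDecomp.vSpace f xbar)
    -- `f` is proper, l.s.c. and properly prox-regular at `xbar` with respect to `epsbar`, `ρ`
    (hproper : UVDecomp.IsProper f) (hlsc : LowerSemicontinuous f)
    (hprox : UVDecomp.ProperlyProxRegularAt f xbar epsbar ρ)
    -- conditions on the constants
    (hρ : 0 < ρ ∧ ρ < 2) (hε : 0 < ε) (hεbar : ε < epsbar)
    -- `xbar` is a local minimizer and `M` is a `C¹` fast track
    (hmin : IsLocalMin f xbar)
    (hfast : UVDecomp.IsFastTrack 1 f xbar ε δ v)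
    -- regular and limiting subdifferentials agree on `M` near `xbar`
    (hreg : ∃ deltahat : ℝ, 0 < deltahat ∧
      ∀ x ∈ Metric.closedBall xbar deltahat ∩ UVDecomp.trackSet f xbar δ v,
        UVDecomp.regularSubdiff f x = UVDecomp.subdiff f x)
    -- interior minimizers
    (hint : ∃ τ : ℝ, 0 < τ ∧ τ ≤ δ ∧
      ∀ u : UVDecomp.uSpace f xbar, ‖u‖ ≤ τ →
        (∀ g ∈ UVDecomp.epsRi f xbar ε,
          (UVDecomp.vMinimizers f xbar ε (UVDecomp.projV f xbar g) u ∩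
            Metric.ball 0 ε).Nonempty) ∧
        v u ∈ Metric.ball (0 : UVDecomp.vSpace f xbar) ε)
    -- the liminf condition on `V`-projections
    (hliminf : UVDecomp.projV f xbar ''
        (UVDecomp.subdiff f xbar \ UVDecomp.epsRi f xbar ε) ⊆
      UVDecomp.innerLimit
        (fun x => UVDecomp.projV f xbar '' UVDecomp.subdiff f x)
        (𝓝[UVDecomp.trackSet f xbar δ v] xbar)) :
    UVDecomp.InnerSemicontinuousAtRel (UVDecomp.subdiff f) xbar
      (UVDecomp.trackSet f xbar δ v) := by
  exact hfast.innerSemicontinuousAtRel hprox.1 hρ.2 hε hεbar hreg hliminf
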